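/- Setting. There are $n$ items $d^1,\dots,d^n$ in an item space $\mathcal D$, a family $\mathcal G$ of (possibly overlapping) groups of these items, and for each group $g$ a maximal candidate-set size $t_g^{\max}$, at most the number of items in $g$. A relevance model $f:\mathcal Q\times\mathcal D\to[0,1]$ is fixed, where $\mathcal Q$ is the space of queries; for a query $q$ and a group $g$, $\sigma_{q,g}(1),\sigma_{q,g}(2),\dots$ are the indices of the items of $g$ in a deterministic order of decreasing $f(q,\cdot)$. A request is a pair $(Q,R)\sim P_{Q,R}$ of a query and a relevance vector $R=(R^1,\dots,R^n)\in\{0,1\}^n$, and $$U_g(t)=\mathbb E_{(Q,R)\sim P_{Q,R}}\Big[\sum_{j=1}^{t}R^{\sigma_{Q,g}(j)}\Big]$$ is the expected number of relevant items among the $t$ top-ranked items of group $g$. Given $(Q,R)=(q,r)$, the vector $O\in\{0,1\}^n$ telling which items the user observes under the logging policy $\pi_0$ has the conditional law $P^{\pi_0}_{O\mid Q=q,R=r}$; the propensity of item $j$ is $p^j(q,r)=\Pr(O^j=1\mid Q=q,R=r;\pi_0)$, and the click on item $j$ is $C^j=O^jR^j$. The triples $(Q_i,R_i,O_i)$, $i=1,\dots,m$,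 with $m>1$, are i.i.d. copies of $(Q,R,O)$; the log consists of the queries $Q_i$, the clicks $C_i^j=O_i^jR_i^j$ and the propensities $p_i^j=p^j(Q_i,R_i)$. Proposition. Assume that there is $\gamma>0$ such that $p^{\sigma_{q,g}(j)}(q,r)>\gamma$ for all $g\in\mathcal G$, $q\in\mathcal Q$, $r\in\{0,1\}^n$ and $1\le j\le t_g^{\max}$. Then for every $\lambda>0$, $g\in\mathcal G$, $t\in\{1,\dots,t_g^{\max}-1\}$ and $\alpha\in(0,1)$, with probability at least $1-\alpha$, $$U_g(t)\;\ge\;\frac1m\sum_{i=1}^m Z_i-\sqrt{\frac{2V_m(Z)\ln(2/\alpha)}{m}}-\frac{7t\lambda\ln(2/\alpha)}{3(m-1)},$$ where $$Z_i=\sum_{j=1}^{t}\min\Big(\lambda,\frac1{p_i^{\sigma_{Q_i,g}(j)}}\Big)C_i^{\sigma_{Q_i,g}(j)},\qquad V_m(Z)=\frac1{m(m-1)}\sum_{1\le i<k\le m}(Z_i-Z_k)^2 .$$ -/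

import Mathlib

open MeasureTheory ProbabilityTheory

noncomputable section

namespace FirstStage

/-- `rank` lists the items of the finite group `S` (a set of indices of items) in order of
decreasing score: `rank j` is the item at position `j`, for the positions `1, …, |S|`. Ties may be
broken in any way; the values of `rank` at other positions carry no meaning. -/
def IsRanking {n : ℕ} (score : Fin n → ℝ) (S : Finset (Fin n)) (rank : ℕ → Fin n) : Prop :=
  Set.BijOn rank (Set.Icc 1 S.card) (S : Set (Fin n)) ∧
    ∀ j k : ℕ, 1 ≤ j → j ≤ k → k ≤ S.card → score (rank k) ≤ score (rank j)

/-- The expected number of relevant items among the `t` top-ranked ones, when the query and the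
relevance vector are drawn from `P`. -/
def expectedRelevant {𝒬 : Type*} [MeasurableSpace 𝒬] {n : ℕ}
    (P : Measure (𝒬 × (Fin n → Bool))) (rank : 𝒬 → ℕ → Fin n) (t : ℕ) : ℝ :=
  ∫ x, ∑ j ∈ Finset.Icc 1 t, ((x.2 (rank x.1 j)).toNat : ℝ) ∂P

/-- The propensity of item `j`: the conditional probability that the user observes item `j`, given
the query `q` and the relevance vector `r`, when the observation vector has the conditional law
`κ (q, r)` induced by the logging policy. -/
def propensity {𝒬 : Type*} [MeasurableSpace 𝒬] {n : ℕ}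
    (κ : Kernel (𝒬 × (Fin n → Bool)) (Fin n → Bool)) (q : 𝒬) (r : Fin n → Bool) (j : Fin n) : ℝ :=
  (κ (q, r)).real {o | o j = true}

/-- The user feedback: an item is clicked iff it is observed and relevant. -/
def clicks {n : ℕ} (o r : Fin n → Bool) (j : Fin n) : Bool := o j && r j

/-- The logged data of one request: the query, the feedback vector and the propensities. -/
structure LogEntry (𝒬 : Type*) (n : ℕ) where
  query : 𝒬
  click : Fin n → Bool
  prop : Fin n → ℝ

/-- The clipped inverse propensity weighted (CIPW) estimate of one request. -/
def cipwScore {𝒬 : Type*} {n : ℕ} (rank : 𝒬 → ℕ → Fin n) (lam : ℝ) (t : ℕ)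
    (e : LogEntry 𝒬 n) : ℝ :=
  ∑ j ∈ Finset.Icc 1 t,
    min lam (1 / e.prop (rank e.query j)) * ((e.click (rank e.query j)).toNat : ℝ)

/-- The CIPW estimator: the average of the CIPW estimates of the requests. -/
def cipwEstimate {𝒬 : Type*} {n m : ℕ} (rank : 𝒬 → ℕ → Fin n) (lam : ℝ) (t : ℕ)
    (S : Fin m → LogEntry 𝒬 n) : ℝ :=
  (1 / (m : ℝ)) * ∑ i, cipwScore rank lam t (S i)

/-- The sample variance of `z 1, …, z m`, in its pairwise form. -/
def sampleVariance {m : ℕ} (z : Fin m → ℝ) : ℝ :=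
  (1 / ((m : ℝ) * ((m : ℝ) - 1))) *
    ∑ i, ∑ j ∈ Finset.univ.filter (fun j => i < j), (z i - z j) ^ 2

/-- The empirical lower confidence bound with failure probability `α`, as a function of the
log. -/
def lowerBound {𝒬 : Type*} {n m : ℕ} (rank : 𝒬 → ℕ → Fin n) (lam : ℝ) (t : ℕ) (α : ℝ)
    (S : Fin m → LogEntry 𝒬 n) : ℝ :=
  cipwEstimate rank lam t S
    - Real.sqrt (2 * sampleVariance (fun i => cipwScore rank lam t (S i)) * Real.log (2 / α) / m)
    - 7 * t * lam * Real.log (2 / α) / (3 * ((m : ℝ) - 1))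

end FirstStage

end

/-! Clipping only lowers the inverse propensity weights. Conditionally on the request, a weighted
click therefore has mean at most the relevance, so `E Z ≤ U_g(t)` (`integral_cipwOfObservation_le`).
Since the `Z_i` are i.i.d. in `[0, tλ]`, it remains to bound how far their average exceeds their
mean: this is the empirical Bernstein inequality of Maurer and Pontil at level `L = ln(2/α)`.

That inequality is a union bound over two events of probability at most `e^{-L}`. One is failure of
Bernstein's inequality with the true variance `v` (`measureReal_bernstein`). The other is `√v`
exceeding the sample standard deviation by more than `√(2L/(m-1))`
(`measureReal_sqrt_sampleVariance_lt`). For the latter, the sample variance is an average, over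
permutations, of means of half squared differences over disjoint pairs. Within one permutation the
pairs are independent, and Jensen's inequality for `exp` carries the bound on the moment generating
function over to the average. -/

/-! ### Elementary bounds for the exponential -/

section ExpBounds

/-- The exponential on `[0, 3)` is at most its `[2/1]` Padé approximant. -/
lemma Real.exp_le_one_add_add_sq_div {x : ℝ} (h0 : 0 ≤ x) (h3 : x < 3) :
    Real.exp x ≤ 1 + x + x ^ 2 / (2 * (1 - x / 3)) := by
  -- The claim times `(6 - 2y) e^{-y}` says that this function is nonnegative. It vanishes at `0`,
  -- and its derivative is nonnegative because `1 + y + y²/2 ≤ e^y`.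
  have hmono : MonotoneOn (fun y : ℝ => (6 + 4 * y + y ^ 2) * Real.exp (-y) - (6 - 2 * y))
      (Set.Ici 0) := by
    have hd : ∀ y : ℝ, HasDerivAt
        (fun y : ℝ => (6 + 4 * y + y ^ 2) * Real.exp (-y) - (6 - 2 * y))
        (2 - (2 + 2 * y + y ^ 2) * Real.exp (-y)) y := by
      intro y
      have h1 : HasDerivAt (fun y : ℝ => 6 + 4 * y + y ^ 2) (4 + 2 * y) y := by
        have := (((hasDerivAt_id y).const_mul 4).const_add 6).add ((hasDerivAt_id y).pow 2)
        convert! this using 1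
        simp
      have h2 : HasDerivAt (fun y : ℝ => Real.exp (-y)) (-Real.exp (-y)) y := by
        convert! (hasDerivAt_neg y).exp using 1
        ring
      have h3 : HasDerivAt (fun y : ℝ => 6 - 2 * y) (-2) y := by
        convert! ((hasDerivAt_id y).const_mul 2).const_sub 6 using 1
        ring
      convert! (h1.mul h2).sub h3 using 1
      ring
    refine monotoneOn_of_deriv_nonneg (convex_Ici 0) (by fun_prop) ?_ ?_
    · exact fun y _ => (hd y).differentiableAt.differentiableWithinAt
    · intro y hy
      rw [interior_Ici] at hy
      rw [(hd y).deriv]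
      have := Real.quadratic_le_exp_of_nonneg (le_of_lt hy)
      have h1 : (1 + y + y ^ 2 / 2) * Real.exp (-y) ≤ 1 := by
        calc _ ≤ Real.exp y * Real.exp (-y) := by gcongr
          _ = 1 := by rw [← Real.exp_add]; simp
      linarith
  have h := hmono (Set.mem_Ici.2 le_rfl) (Set.mem_Ici.2 h0) h0
  simp only [mul_zero, add_zero, neg_zero, Real.exp_zero, mul_one, sub_zero] at h
  norm_num at h
  have h' : (6 - 2 * x) * Real.exp x ≤ 6 + 4 * x + x ^ 2 := by
    have h2 : (6 - 2 * x) * Real.exp x ≤ ((6 + 4 * x + x ^ 2) * Real.exp (-x)) * Real.exp x := by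
      gcongr
      linarith
    rwa [mul_assoc, ← Real.exp_add, neg_add_cancel, Real.exp_zero, mul_one] at h2
  have hpos : 0 < 6 - 2 * x := by linarith
  have heq : 1 + x + x ^ 2 / (2 * (1 - x / 3)) = (6 + 4 * x + x ^ 2) / (6 - 2 * x) := by
    have h6 : 6 - 2 * x ≠ 0 := hpos.ne'
    have : 2 * (1 - x / 3) = (6 - 2 * x) / 3 := by ring
    rw [this, div_div_eq_mul_div, eq_div_iff h6, add_mul, div_mul_cancel₀ _ h6]
    ring
  rw [heq, le_div_iff₀ hpos]
  linarith

/-- The exponential of a negative number is at most its second order Taylor polynomial. -/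
lemma Real.exp_neg_le_one_sub_add_sq_div_two {x : ℝ} (h0 : 0 ≤ x) :
    Real.exp (-x) ≤ 1 - x + x ^ 2 / 2 := by
  have hmono : MonotoneOn (fun y : ℝ => 1 - y + y ^ 2 / 2 - Real.exp (-y)) (Set.Ici 0) := by
    have hd : ∀ y : ℝ, HasDerivAt (fun y : ℝ => 1 - y + y ^ 2 / 2 - Real.exp (-y))
        (-1 + y + Real.exp (-y)) y := by
      intro y
      have h2 : HasDerivAt (fun y : ℝ => Real.exp (-y)) (-Real.exp (-y)) y := by
        convert! (hasDerivAt_neg y).exp using 1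
        ring
      convert! (((hasDerivAt_id y).const_sub 1).add (((hasDerivAt_id y).pow 2).div_const 2)).sub h2
        using 1
      simp
    refine monotoneOn_of_deriv_nonneg (convex_Ici 0) (by fun_prop) ?_ ?_
    · exact fun y _ => (hd y).differentiableAt.differentiableWithinAt
    · intro y _
      rw [(hd y).deriv]
      linarith [Real.add_one_le_exp (-y)]
  have h := hmono (Set.mem_Ici.2 le_rfl) (Set.mem_Ici.2 h0) h0
  norm_num at h
  linarith

/-- For `y ≥ 0` the Padé bound at `θy` has denominator `2(1 - θy/3) ≥ 2(1 - θ/3)`; for `y ≤ 0` the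
Taylor bound has the still larger denominator `2`. No lower bound on `y` enters. -/
lemma Real.exp_mul_le_of_le_one {θ y : ℝ} (h0 : 0 ≤ θ) (h3 : θ < 3) (hy : y ≤ 1) :
    Real.exp (θ * y) ≤ 1 + θ * y + y ^ 2 * (θ ^ 2 / (2 * (1 - θ / 3))) := by
  have hθ : 0 < 1 - θ / 3 := by linarith
  have key : ∀ z : ℝ, 0 < z → 1 - θ / 3 ≤ z →
      (θ * y) ^ 2 / (2 * z) ≤ y ^ 2 * (θ ^ 2 / (2 * (1 - θ / 3))) := by
    intro z hz hzl
    rw [mul_pow, mul_comm, mul_div_assoc]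
    gcongr
  rcases le_total 0 y with hy0 | hy0
  · have h1 : θ * y ≤ θ := mul_le_of_le_one_right h0 hy
    have h2 := Real.exp_le_one_add_add_sq_div (mul_nonneg h0 hy0) (h1.trans_lt h3)
    linarith [key (1 - θ * y / 3) (by linarith) (by linarith)]
  · have h2 := Real.exp_neg_le_one_sub_add_sq_div_two (x := -(θ * y))
      (by nlinarith [mul_nonneg h0 (neg_nonneg.2 hy0)])
    rw [neg_neg, neg_sq] at h2
    have := key 1 one_pos (by linarith)
    rw [mul_one] at this
    linarith

end ExpBounds

/-! ### Bernstein's inequality with the true variance -/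

section Bernstein

variable {Ω : Type*} [MeasurableSpace Ω] {μ : Measure Ω} [IsProbabilityMeasure μ]

lemma integrable_of_mem_Icc {X : Ω → ℝ} {a b : ℝ} (hX : AEMeasurable X μ)
    (hb : ∀ ω, X ω ∈ Set.Icc a b) : Integrable X μ :=
  Integrable.of_mem_Icc a b hX (ae_of_all _ hb)

/-- Bernstein's bound for the moment generating function of a centered variable. -/
lemma mgf_sub_integral_le {X : Ω → ℝ} (hX : AEMeasurable X μ) (hb : ∀ ω, X ω ∈ Set.Icc (0 : ℝ) 1)
    {θ : ℝ} (h0 : 0 ≤ θ) (h3 : θ < 3) :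
    mgf (fun ω => X ω - μ[X]) μ θ ≤ Real.exp (Var[X; μ] * (θ ^ 2 / (2 * (1 - θ / 3)))) := by
  have hXi : Integrable X μ := integrable_of_mem_Icc hX hb
  have he0 : 0 ≤ μ[X] := integral_nonneg fun ω => (hb ω).1
  have he1 : μ[X] ≤ 1 := by
    calc μ[X] ≤ ∫ _, (1 : ℝ) ∂μ := integral_mono hXi (integrable_const _) fun ω => (hb ω).2
      _ = 1 := by simp
  set e := μ[X]
  have hY : ∀ ω, X ω - e ∈ Set.Icc (-1 : ℝ) 1 := fun ω =>
    ⟨by linarith [(hb ω).1], by linarith [(hb ω).2]⟩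
  have hsq : Integrable (fun ω => (X ω - e) ^ 2) μ :=
    integrable_of_mem_Icc (a := 0) (b := 1) (by fun_prop) fun ω =>
      ⟨sq_nonneg _, by nlinarith [(hY ω).1, (hY ω).2]⟩
  have hlin : Integrable (fun ω => 1 + θ * (X ω - e)) μ :=
    (integrable_const _).add ((hXi.sub (integrable_const _)).const_mul _)
  have hexp : Integrable (fun ω => Real.exp (θ * (X ω - e))) μ :=
    integrable_of_mem_Icc (a := 0) (b := Real.exp θ)
      (Real.measurable_exp.comp_aemeasurable (by fun_prop)) fun ω =>
      ⟨(Real.exp_pos _).le, Real.exp_le_exp.2 (mul_le_of_le_one_right h0 (hY ω).2)⟩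
  set K := θ ^ 2 / (2 * (1 - θ / 3))
  calc mgf (fun ω => X ω - e) μ θ
      ≤ ∫ ω, (1 + θ * (X ω - e) + (X ω - e) ^ 2 * K) ∂μ :=
        integral_mono hexp (hlin.add (hsq.mul_const _)) fun ω =>
          Real.exp_mul_le_of_le_one h0 h3 (hY ω).2
    _ = 1 + Var[X; μ] * K := by
        have hone : ∫ ω, (1 + θ * (X ω - e)) ∂μ = 1 := by
          have hsub : Integrable (fun ω => X ω - e) μ := hXi.sub (integrable_const _)
          rw [integral_add (integrable_const _) (hsub.const_mul _), integral_const_mul,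
            integral_sub hXi (integrable_const _)]
          simp [e]
        rw [integral_add hlin (hsq.mul_const _), integral_mul_const, variance_eq_integral hX, hone]
    _ ≤ _ := by linarith [Real.add_one_le_exp (Var[X; μ] * K)]

/-- Bernstein's inequality for the average of independent variables with values in `[0, 1]`. -/
lemma measureReal_bernstein {m : ℕ} (hm : 0 < m) {X : Fin m → Ω → ℝ}
    (hX : ∀ i, AEMeasurable (X i) μ) (hb : ∀ i ω, X i ω ∈ Set.Icc (0 : ℝ) 1)
    (hindep : iIndepFun X μ) {e v L : ℝ} (he : ∀ i, μ[X i] = e) (hv : ∀ i, Var[X i; μ] = v)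
    (hL : 0 < L) :
    μ.real {ω | e + √(2 * v * L / m) + L / (3 * m) < (1 / m) * ∑ i, X i ω} ≤ Real.exp (-L) := by
  have hm' : (0 : ℝ) < m := by exact_mod_cast hm
  have hv0 : 0 ≤ v := by rw [← hv ⟨0, hm⟩]; exact variance_nonneg _ _
  -- The Chernoff parameter below divides by `v`. If `v = 0`, the variables are almost surely
  -- constant and the event is null.
  rcases hv0.eq_or_lt with rfl | hvpos
  · have hae : ∀ᵐ ω ∂μ, ∀ i, X i ω = e := by
      rw [ae_all_iff]
      intro i
      rw [← he i]
      refine ae_eq_integral_of_variance_eq_zero ?_ (hv i)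
      exact MemLp.of_bound (hX i).aestronglyMeasurable 1 (ae_of_all _ fun ω => by
        rw [Real.norm_eq_abs, abs_le]; exact ⟨by linarith [(hb i ω).1], (hb i ω).2⟩)
    have hzero : μ {ω | e + √(2 * 0 * L / m) + L / (3 * m) < (1 / m) * ∑ i, X i ω} = 0 := by
      rw [← nonpos_iff_eq_zero, ← (ae_iff.1 hae)]
      refine measure_mono fun ω hω hall => ?_
      simp only [Set.mem_ofPred_eq, hall, Finset.sum_const, Finset.card_univ, Fintype.card_fin,
        nsmul_eq_mul] at hω
      have h1 : 1 / (m : ℝ) * (m * e) = e := by field_simp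
      rw [h1] at hω
      have : 0 ≤ √(2 * 0 * L / m) := Real.sqrt_nonneg _
      have : 0 < L / (3 * m) := by positivity
      linarith
    rw [measureReal_def, hzero]
    simpa using (Real.exp_pos _).le
  · set u : ℝ := √(2 * L / (m * v)) with hu
    have hupos : 0 < u := by positivity
    have hu2 : u ^ 2 = 2 * L / (m * v) := Real.sq_sqrt (by positivity)
    have hLu : L = m * v * u ^ 2 / 2 := by rw [hu2]; field_simp
    have hsq : √(2 * v * L / m) = v * u := by
      rw [Real.sqrt_eq_iff_mul_self_eq (by positivity) (by positivity), hLu]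
      field_simp
    -- Here `1 - θ/3 = 1/(1 + u/3)`, and since `L = m v u²/2` the deviation is `v u + v u²/6`. The
    -- Chernoff exponent is then exactly `-L`.
    set θ : ℝ := u / (1 + u / 3) with hθ
    have hθ0 : 0 ≤ θ := by positivity
    have hθ3 : θ < 3 := by rw [hθ, div_lt_iff₀ (by positivity)]; linarith
    have hYm : ∀ i, AEMeasurable (fun ω => X i ω - e) μ := fun i => by fun_prop
    have hYind : iIndepFun (fun i ω => X i ω - e) μ :=
      hindep.comp (fun _ x => x - e) fun _ => by fun_prop
    have hmgf := hYind.mgf_sum₀ (t := θ) hYm Finset.univ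
    have hmgf_le : mgf (∑ i, fun ω => X i ω - e) μ θ
        ≤ Real.exp (m * (v * (θ ^ 2 / (2 * (1 - θ / 3))))) := by
      rw [hmgf]
      calc ∏ i, mgf (fun ω => X i ω - e) μ θ
          ≤ ∏ _i : Fin m, Real.exp (v * (θ ^ 2 / (2 * (1 - θ / 3)))) := by
            refine Finset.prod_le_prod (fun i _ => mgf_nonneg) fun i _ => ?_
            have := mgf_sub_integral_le (hX i) (hb i) hθ0 hθ3
            rwa [he i, hv i] at this
        _ = _ := by
            rw [Finset.prod_const, Finset.card_univ, Fintype.card_fin, ← Real.exp_nat_mul]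
    have hYb : ∀ ω, (∑ i, fun ω => X i ω - e) ω ≤ m * (1 - e) := fun ω => by
      rw [Finset.sum_apply]
      calc _ ≤ ∑ _i : Fin m, (1 - e) := Finset.sum_le_sum fun i _ => by linarith [(hb i ω).2]
        _ = _ := by simp [mul_sub]
    have hint : Integrable (fun ω => Real.exp (θ * (∑ i, fun ω => X i ω - e) ω)) μ := by
      refine integrable_of_mem_Icc (a := 0) (b := Real.exp (θ * (m * (1 - e)))) ?_ fun ω =>
        ⟨(Real.exp_pos _).le, Real.exp_le_exp.2 (mul_le_mul_of_nonneg_left (hYb ω) hθ0)⟩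
      have : AEMeasurable (∑ i, fun ω => X i ω - e) μ := Finset.aemeasurable_sum _ fun i _ => hYm i
      fun_prop
    have hch := measure_ge_le_exp_mul_mgf (m * (√(2 * v * L / m) + L / (3 * m))) hθ0 hint
    have hsub : {ω | e + √(2 * v * L / m) + L / (3 * m) < (1 / m) * ∑ i, X i ω} ⊆
        {ω | m * (√(2 * v * L / m) + L / (3 * m)) ≤ (∑ i, fun ω => X i ω - e) ω} := by
      intro ω hω
      simp only [Set.mem_ofPred_eq, Finset.sum_apply, Finset.sum_sub_distrib, Finset.sum_const,
        Finset.card_univ, Fintype.card_fin, nsmul_eq_mul] at hω ⊢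
      have h1 : (m : ℝ) * ((1 / m) * ∑ i, X i ω) = ∑ i, X i ω := by field_simp
      have h2 := mul_lt_mul_of_pos_left hω hm'
      rw [h1] at h2
      linarith
    refine (measureReal_mono hsub).trans (hch.trans ?_)
    refine (mul_le_mul_of_nonneg_left hmgf_le (Real.exp_pos _).le).trans ?_
    rw [← Real.exp_add]
    refine Real.exp_le_exp.2 (le_of_eq ?_)
    have h1θ : 1 - θ / 3 = 1 / (1 + u / 3) := by rw [hθ]; field_simp; ring
    rw [hsq, h1θ, hθ, hLu]
    field_simp
    ring

end Bernstein

/-! ### Averages over the symmetric group -/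

section PermAverage

variable {ι : Type*} [Fintype ι] [DecidableEq ι]

/-- The symmetric group is 2-transitive: translate the sum by a permutation sending `(a, b)` to
`(a', b')`. -/
lemma sum_perm_apply_apply_eq (F : ι → ι → ℝ) {a b a' b' : ι} (h : a ≠ b) (h' : a' ≠ b') :
    ∑ π : Equiv.Perm ι, F (π a) (π b) = ∑ π : Equiv.Perm ι, F (π a') (π b') := by
  obtain ⟨τ, ha, hb⟩ : ∃ τ : Equiv.Perm ι, τ a = a' ∧ τ b = b' := by
    refine ⟨Equiv.swap b' (Equiv.swap a a' b) * Equiv.swap a a', ?_, ?_⟩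
    · rw [Equiv.Perm.mul_apply, Equiv.swap_apply_left]
      refine Equiv.swap_apply_of_ne_of_ne h' fun he => h ?_
      apply (Equiv.swap a a').injective
      rw [Equiv.swap_apply_left, ← he]
    · rw [Equiv.Perm.mul_apply, Equiv.swap_apply_right]
  refine (Fintype.sum_equiv (Equiv.mulRight τ) _ _ fun π => ?_).symm
  simp [ha, hb]

/-- The average of `F` over the images of a fixed pair of distinct points under all permutations. -/
lemma sum_perm_apply_apply_mul (F : ι → ι → ℝ) (hF : ∀ i, F i i = 0) {a b : ι} (h : a ≠ b) :
    (∑ π : Equiv.Perm ι, F (π a) (π b)) * ((Fintype.card ι : ℝ) * ((Fintype.card ι : ℝ) - 1)) =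
      Fintype.card (Equiv.Perm ι) * ∑ i, ∑ j, F i j := by
  -- Double counting: each permutation merely reindexes the double sum. On the other side, the
  -- diagonal contributes nothing and the `N(N-1)` off-diagonal pairs (`N = card ι`) contribute
  -- equally.
  have h1 : ∑ i, ∑ j, ∑ π : Equiv.Perm ι, F (π i) (π j) =
      Fintype.card (Equiv.Perm ι) * ∑ i, ∑ j, F i j := by
    have : ∑ i, ∑ j, ∑ π : Equiv.Perm ι, F (π i) (π j) =
        ∑ π : Equiv.Perm ι, ∑ i, ∑ j, F (π i) (π j) := by
      rw [Finset.sum_congr rfl fun i _ => Finset.sum_comm, Finset.sum_comm]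
    rw [this]
    have h2 : ∀ π : Equiv.Perm ι, ∑ i, ∑ j, F (π i) (π j) = ∑ i, ∑ j, F i j := fun π =>
      (Finset.sum_congr rfl fun i _ => Equiv.sum_comp π fun j => F (π i) j).trans
        (Equiv.sum_comp π fun i => ∑ j, F i j)
    rw [Finset.sum_congr rfl fun π _ => h2 π, Finset.sum_const, Finset.card_univ, nsmul_eq_mul]
  rw [← h1]
  have h3 : ∀ i j, ∑ π : Equiv.Perm ι, F (π i) (π j) =
      if i = j then 0 else ∑ π : Equiv.Perm ι, F (π a) (π b) := by
    intro i j
    split_ifs with hij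
    · subst hij; simp [hF]
    · exact sum_perm_apply_apply_eq F hij h
  set c := ∑ π : Equiv.Perm ι, F (π a) (π b)
  have h4 : ∀ i : ι, ∑ j, (if i = j then (0 : ℝ) else c) = (Fintype.card ι - 1) * c := by
    intro i
    have : ∀ j, (if i = j then (0 : ℝ) else c) = c - if i = j then c else 0 := by
      intro j; split_ifs <;> ring
    simp_rw [this, Finset.sum_sub_distrib]
    simp
    ring
  simp_rw [h3, h4]
  simp
  ring

end PermAverage

/-! ### The sample variance as a U-statistic -/

section SampleVariance

lemma sampleVariance_eq_sum_sum {m : ℕ} (z : Fin m → ℝ) :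
    FirstStage.sampleVariance z =
      (1 / ((m : ℝ) * ((m : ℝ) - 1))) * ∑ i, ∑ j, (z i - z j) ^ 2 / 2 := by
  unfold FirstStage.sampleVariance
  congr 1
  have hsplit : ∀ i j : Fin m, (z i - z j) ^ 2 / 2 =
      (if i < j then (z i - z j) ^ 2 / 2 else 0) + if j < i then (z j - z i) ^ 2 / 2 else 0 := by
    intro i j
    rcases lt_trichotomy i j with h | h | h
    · simp [h, h.not_gt]
    · simp [h]
    · simp only [h, h.not_gt, if_true, if_false]; ring
  have hswap : ∑ i : Fin m, ∑ j, (if j < i then (z j - z i) ^ 2 / 2 else 0) =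
      ∑ i : Fin m, ∑ j, (if i < j then (z i - z j) ^ 2 / 2 else 0) := Finset.sum_comm
  rw [Finset.sum_congr rfl fun i _ => Finset.sum_congr rfl fun j _ => hsplit i j]
  simp_rw [Finset.sum_add_distrib]
  rw [hswap, ← two_mul, Finset.mul_sum]
  refine Finset.sum_congr rfl fun i _ => ?_
  rw [Finset.sum_filter, Finset.mul_sum]
  refine Finset.sum_congr rfl fun j _ => ?_
  split_ifs <;> ring

/-- Half of the squared differences of the pairs of entries at the positions `2i` and `2i + 1`. -/
noncomputable def pairedSum {m : ℕ} (z : Fin m → ℝ) (π : Equiv.Perm (Fin m)) : ℝ :=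
  ∑ i : Fin (m / 2), (z (π ⟨2 * i, by omega⟩) - z (π ⟨2 * i + 1, by omega⟩)) ^ 2 / 2

/-- The sample variance is an average over all permutations (Hoeffding's representation of a
`U`-statistic by averages over disjoint pairs). -/
lemma sampleVariance_mul_eq_sum_perm {m : ℕ} (hm : 1 < m) (z : Fin m → ℝ) :
    ((m / 2 : ℕ) : ℝ) * FirstStage.sampleVariance z =
      ∑ π : Equiv.Perm (Fin m), (1 / (Fintype.card (Equiv.Perm (Fin m)) : ℝ)) * pairedSum z π := by
  have hm1 : (1 : ℝ) < m := by exact_mod_cast hm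
  have hm0 : (m : ℝ) * ((m : ℝ) - 1) ≠ 0 := by
    have : (0 : ℝ) < m * ((m : ℝ) - 1) := mul_pos (by linarith) (by linarith)
    exact this.ne'
  have hc : (Fintype.card (Equiv.Perm (Fin m)) : ℝ) ≠ 0 := by
    exact_mod_cast Fintype.card_ne_zero
  rw [← Finset.mul_sum, sampleVariance_eq_sum_sum]
  unfold pairedSum
  rw [Finset.sum_comm (s := (Finset.univ : Finset (Equiv.Perm (Fin m))))]
  have key : ∀ i : Fin (m / 2), ∑ π : Equiv.Perm (Fin m),
      (z (π ⟨2 * i, by omega⟩) - z (π ⟨2 * i + 1, by omega⟩)) ^ 2 / 2 =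
      (Fintype.card (Equiv.Perm (Fin m)) : ℝ) *
        ((1 / ((m : ℝ) * ((m : ℝ) - 1))) * ∑ i, ∑ j, (z i - z j) ^ 2 / 2) := by
    intro i
    have := sum_perm_apply_apply_mul (fun i j => (z i - z j) ^ 2 / 2) (by simp)
      (a := (⟨2 * i, by omega⟩ : Fin m)) (b := ⟨2 * i + 1, by omega⟩) (by simp)
    rw [Fintype.card_fin] at this
    rw [← mul_left_inj' hm0, this]
    generalize ∑ i, ∑ j, (z i - z j) ^ 2 / 2 = S
    rw [mul_assoc, mul_comm _ ((m : ℝ) * (m - 1)), ← mul_assoc ((m : ℝ) * (m - 1)),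
      mul_one_div_cancel hm0, one_mul]
  rw [Finset.sum_congr rfl fun i _ => key i, Finset.sum_const, Finset.card_univ, Fintype.card_fin,
    nsmul_eq_mul]
  generalize 1 / ((m : ℝ) * ((m : ℝ) - 1)) * ∑ i, ∑ j, (z i - z j) ^ 2 / 2 = A
  field_simp

lemma sampleVariance_nonneg {m : ℕ} (z : Fin m → ℝ) : 0 ≤ FirstStage.sampleVariance z := by
  unfold FirstStage.sampleVariance
  rcases Nat.eq_zero_or_pos m with rfl | hm
  · simp
  · have : (1 : ℝ) ≤ m := by exact_mod_cast hm
    refine mul_nonneg (one_div_nonneg.2 (mul_nonneg (by linarith) (by linarith))) ?_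
    exact Finset.sum_nonneg fun i _ => Finset.sum_nonneg fun j _ => sq_nonneg _

lemma sampleVariance_const_mul {m : ℕ} (c : ℝ) (z : Fin m → ℝ) :
    FirstStage.sampleVariance (fun i => c * z i) = c ^ 2 * FirstStage.sampleVariance z := by
  unfold FirstStage.sampleVariance
  simp_rw [← mul_sub, mul_pow, ← Finset.mul_sum]
  ring

end SampleVariance

/-! ### Lower tail of the sample variance and the empirical Bernstein inequality -/

section LowerTail

variable {Ω : Type*} [MeasurableSpace Ω] {μ : Measure Ω} [IsProbabilityMeasure μ]

lemma memLp_two_of_mem_Icc {X : Ω → ℝ} (hX : AEMeasurable X μ)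
    (hb : ∀ ω, X ω ∈ Set.Icc (0 : ℝ) 1) : MemLp X 2 μ :=
  MemLp.of_bound hX.aestronglyMeasurable 1 (ae_of_all _ fun ω => by
    rw [Real.norm_eq_abs, abs_le]; exact ⟨by linarith [(hb ω).1], (hb ω).2⟩)

/-- Expanding the square, the cross term factors by independence and the means cancel. This makes
each pair an unbiased estimate of the variance. -/
lemma integral_sq_sub_div_two {X Y : Ω → ℝ} (hX : AEMeasurable X μ) (hY : AEMeasurable Y μ)
    (hXb : ∀ ω, X ω ∈ Set.Icc (0 : ℝ) 1) (hYb : ∀ ω, Y ω ∈ Set.Icc (0 : ℝ) 1)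
    (hind : IndepFun X Y μ) (he : μ[X] = μ[Y]) {v : ℝ} (hvX : Var[X; μ] = v)
    (hvY : Var[Y; μ] = v) : ∫ ω, (X ω - Y ω) ^ 2 / 2 ∂μ = v := by
  have hX2 := memLp_two_of_mem_Icc hX hXb
  have hY2 := memLp_two_of_mem_Icc hY hYb
  have hXi := hX2.integrable_sq
  have hYi := hY2.integrable_sq
  have hXY : Integrable (fun ω => X ω * Y ω) μ := hX2.integrable_mul hY2
  have hprod : ∫ ω, X ω * Y ω ∂μ = μ[X] * μ[Y] :=
    hind.integral_fun_mul_eq_mul_integral hX.aestronglyMeasurable hY.aestronglyMeasurable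
  have h1 := variance_eq_sub hX2
  have h2 := variance_eq_sub hY2
  have hsum : Integrable (fun ω => X ω ^ 2 + Y ω ^ 2) μ := hXi.add hYi
  have hexp : ∀ ω, (X ω - Y ω) ^ 2 / 2 = (X ω ^ 2 + Y ω ^ 2) / 2 - X ω * Y ω := fun ω => by ring
  simp_rw [hexp]
  rw [integral_sub (hsum.div_const 2) hXY, integral_div, integral_add hXi hYi, hprod]
  simp only [Pi.pow_apply] at h1 h2
  rw [hvX] at h1
  rw [hvY] at h2
  rw [he] at h1 ⊢
  linarith

/-- With `D = (X - Y)²/2 ∈ [0, 1/2]` one has `D² ≤ D/2`, so `e^{-cD} ≤ 1 - cD + c²D²/2 ≤ 1 - (c -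
c²/4) D`. The second moment of `D` is thus absorbed by its mean `v`. -/
lemma mgf_sq_sub_div_two_le {X Y : Ω → ℝ} (hX : AEMeasurable X μ) (hY : AEMeasurable Y μ)
    (hXb : ∀ ω, X ω ∈ Set.Icc (0 : ℝ) 1) (hYb : ∀ ω, Y ω ∈ Set.Icc (0 : ℝ) 1)
    (hind : IndepFun X Y μ) (he : μ[X] = μ[Y]) {v : ℝ} (hvX : Var[X; μ] = v)
    (hvY : Var[Y; μ] = v) {c : ℝ} (hc : 0 ≤ c) :
    mgf (fun ω => (X ω - Y ω) ^ 2 / 2) μ (-c) ≤ Real.exp (-((c - c ^ 2 / 4) * v)) := by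
  have hv := integral_sq_sub_div_two hX hY hXb hYb hind he hvX hvY
  have hD : ∀ ω, (X ω - Y ω) ^ 2 / 2 ∈ Set.Icc (0 : ℝ) (1 / 2) := fun ω =>
    ⟨by positivity, by nlinarith [(hXb ω).1, (hXb ω).2, (hYb ω).1, (hYb ω).2]⟩
  have hDi : Integrable (fun ω => (X ω - Y ω) ^ 2 / 2) μ := integrable_of_mem_Icc (by fun_prop) hD
  have hexp : Integrable (fun ω => Real.exp (-c * ((X ω - Y ω) ^ 2 / 2))) μ :=
    integrable_of_mem_Icc (a := 0) (b := 1) (Real.measurable_exp.comp_aemeasurable (by fun_prop))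
      fun ω => ⟨(Real.exp_pos _).le, Real.exp_le_one_iff.2 (by nlinarith [mul_nonneg hc (hD ω).1])⟩
  calc mgf (fun ω => (X ω - Y ω) ^ 2 / 2) μ (-c)
      ≤ ∫ ω, (1 - (c - c ^ 2 / 4) * ((X ω - Y ω) ^ 2 / 2)) ∂μ := by
        refine integral_mono hexp ((integrable_const _).sub (hDi.const_mul _)) fun ω => ?_
        obtain ⟨h0, h1⟩ := hD ω
        simp only
        generalize (X ω - Y ω) ^ 2 / 2 = y at h0 h1
        have := Real.exp_neg_le_one_sub_add_sq_div_two (mul_nonneg hc h0)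
        rw [← neg_mul] at this
        nlinarith [mul_nonneg (mul_nonneg (sq_nonneg c) h0) (sub_nonneg.2 h1)]
    _ = 1 - (c - c ^ 2 / 4) * v := by
        rw [integral_sub (integrable_const _) (hDi.const_mul _), integral_const_mul, hv]
        simp
    _ ≤ _ := by linarith [Real.add_one_le_exp (-((c - c ^ 2 / 4) * v))]

/-- The pairs use disjoint sets of indices, so a new pair is independent of the sum over the earlier
ones and the moment generating functions multiply. -/
lemma mgf_sum_pairs_le {ι κ : Type*} {X : ι → Ω → ℝ} (hX : ∀ i, AEMeasurable (X i) μ)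
    (hb : ∀ i ω, X i ω ∈ Set.Icc (0 : ℝ) 1) (hindep : iIndepFun X μ) {e v : ℝ}
    (he : ∀ i, μ[X i] = e) (hv : ∀ i, Var[X i; μ] = v) {c : ℝ} (hc : 0 ≤ c) {a b : κ → ι}
    (ha : Function.Injective a) (hbi : Function.Injective b) (hab : ∀ i j, a i ≠ b j)
    (s : Finset κ) :
    mgf (fun ω => ∑ i ∈ s, (X (a i) ω - X (b i) ω) ^ 2 / 2) μ (-c) ≤
      Real.exp (-((c - c ^ 2 / 4) * v)) ^ s.card := by
  classical
  induction s using Finset.induction_on with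
  | empty => simp [mgf]
  | insert k s hk ih =>
    have hmeas : AEMeasurable (fun ω => ∑ i ∈ s, (X (a i) ω - X (b i) ω) ^ 2 / 2) μ :=
      Finset.aemeasurable_fun_sum _ fun i _ => by fun_prop
    have hmeask : AEMeasurable (fun ω => (X (a k) ω - X (b k) ω) ^ 2 / 2) μ := by fun_prop
    have hdisj : Disjoint ({a k, b k} : Finset ι) (s.image a ∪ s.image b) := by
      rw [Finset.disjoint_left]
      intro x hx hx'
      simp only [Finset.mem_insert, Finset.mem_singleton, Finset.mem_union,
        Finset.mem_image] at hx hx'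
      rcases hx with rfl | rfl <;> rcases hx' with ⟨j, hj, h⟩ | ⟨j, hj, h⟩
      · exact hk (ha h ▸ hj)
      · exact hab _ _ h.symm
      · exact hab _ _ h
      · exact hk (hbi h ▸ hj)
    have hI := hindep.indepFun_finset₀ _ _ hdisj hX
    have hI' : IndepFun (fun ω => (X (a k) ω - X (b k) ω) ^ 2 / 2)
        (fun ω => ∑ i ∈ s, (X (a i) ω - X (b i) ω) ^ 2 / 2) μ := by
      have h1 : Measurable fun x : ({a k, b k} : Finset ι) → ℝ =>
          (x ⟨a k, by simp⟩ - x ⟨b k, by simp⟩) ^ 2 / 2 := by fun_prop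
      have h2 : Measurable fun x : (s.image a ∪ s.image b : Finset ι) → ℝ =>
          ∑ i : s, (x ⟨a i, Finset.mem_union_left _ (Finset.mem_image_of_mem _ i.2)⟩ -
            x ⟨b i, Finset.mem_union_right _ (Finset.mem_image_of_mem _ i.2)⟩) ^ 2 / 2 :=
        Finset.measurable_fun_sum _ fun i _ => by fun_prop
      have h3 := hI.comp h1 h2
      convert! h3 using 1
      ext ω
      exact (Finset.sum_coe_sort s fun i => (X (a i) ω - X (b i) ω) ^ 2 / 2).symm
    have hsum : (fun ω => ∑ i ∈ insert k s, (X (a i) ω - X (b i) ω) ^ 2 / 2) =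
        (fun ω => (X (a k) ω - X (b k) ω) ^ 2 / 2) +
          fun ω => ∑ i ∈ s, (X (a i) ω - X (b i) ω) ^ 2 / 2 := by
      ext ω
      simp [Finset.sum_insert hk]
    rw [hsum, hI'.mgf_add' hmeask.aestronglyMeasurable hmeas.aestronglyMeasurable,
      Finset.card_insert_of_notMem hk, pow_succ']
    refine mul_le_mul ?_ ih mgf_nonneg (Real.exp_pos _).le
    exact mgf_sq_sub_div_two_le (hX _) (hX _) (hb _) (hb _) (hindep.indepFun (hab _ _))
      (by rw [he, he]) (hv _) (hv _) hc

lemma mgf_pairedSum_le {m : ℕ} {X : Fin m → Ω → ℝ} (hX : ∀ i, AEMeasurable (X i) μ)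
    (hb : ∀ i ω, X i ω ∈ Set.Icc (0 : ℝ) 1) (hindep : iIndepFun X μ) {e v : ℝ}
    (he : ∀ i, μ[X i] = e) (hv : ∀ i, Var[X i; μ] = v) {c : ℝ} (hc : 0 ≤ c)
    (π : Equiv.Perm (Fin m)) :
    mgf (fun ω => pairedSum (fun i => X i ω) π) μ (-c) ≤
      Real.exp (-((m / 2 : ℕ) * ((c - c ^ 2 / 4) * v))) := by
  have h := mgf_sum_pairs_le hX hb hindep he hv hc
    (a := fun i : Fin (m / 2) => π ⟨2 * i, by omega⟩)
    (b := fun i : Fin (m / 2) => π ⟨2 * i + 1, by omega⟩)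
    (fun i j hij => by
      have := Fin.mk.inj_iff.1 (π.injective hij); omega)
    (fun i j hij => by
      have := Fin.mk.inj_iff.1 (π.injective hij); omega)
    (fun i j hij => by
      have := Fin.mk.inj_iff.1 (π.injective hij); omega)
    Finset.univ
  rw [Finset.card_univ, Fintype.card_fin, ← Real.exp_nat_mul, mul_neg] at h
  exact h

/-- Lower tail of the sample variance of independent variables with values in `[0, 1]`. -/
lemma mgf_sampleVariance_le {m : ℕ} (hm : 1 < m) {X : Fin m → Ω → ℝ}
    (hX : ∀ i, AEMeasurable (X i) μ) (hb : ∀ i ω, X i ω ∈ Set.Icc (0 : ℝ) 1)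
    (hindep : iIndepFun X μ) {e v : ℝ} (he : ∀ i, μ[X i] = e) (hv : ∀ i, Var[X i; μ] = v)
    {c : ℝ} (hc : 0 ≤ c) :
    mgf (fun ω => (m / 2 : ℕ) * FirstStage.sampleVariance (fun i => X i ω)) μ (-c) ≤
      Real.exp (-((m / 2 : ℕ) * ((c - c ^ 2 / 4) * v))) := by
  set N : ℝ := (Fintype.card (Equiv.Perm (Fin m)) : ℝ) with hN
  have hN0 : 0 < N := by rw [hN]; exact_mod_cast Fintype.card_pos
  have hPm : ∀ π, AEMeasurable (fun ω => pairedSum (fun i => X i ω) π) μ := fun π => by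
    unfold pairedSum
    exact Finset.aemeasurable_fun_sum _ fun i _ => by fun_prop
  have hP0 : ∀ π ω, 0 ≤ pairedSum (fun i => X i ω) π := fun π ω =>
    Finset.sum_nonneg fun i _ => by positivity
  have hVeq := fun ω => sampleVariance_mul_eq_sum_perm hm (fun i => X i ω)
  have hVm : AEMeasurable
      (fun ω => ((m / 2 : ℕ) : ℝ) * FirstStage.sampleVariance (fun i => X i ω)) μ := by
    simp_rw [hVeq]
    exact Finset.aemeasurable_fun_sum _ fun π _ => (hPm π).const_mul _
  have hle1 : ∀ y : ℝ, 0 ≤ y → Real.exp (-c * y) ∈ Set.Icc (0 : ℝ) 1 := fun y hy =>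
    ⟨(Real.exp_pos _).le, Real.exp_le_one_iff.2 (by nlinarith [mul_nonneg hc hy])⟩
  have hPi : ∀ π, Integrable (fun ω => Real.exp (-c * pairedSum (fun i => X i ω) π)) μ := fun π =>
    integrable_of_mem_Icc (Real.measurable_exp.comp_aemeasurable ((hPm π).const_mul _))
      fun ω => hle1 _ (hP0 π ω)
  have hVi : Integrable (fun ω => Real.exp
      (-c * (((m / 2 : ℕ) : ℝ) * FirstStage.sampleVariance (fun i => X i ω)))) μ :=
    integrable_of_mem_Icc (Real.measurable_exp.comp_aemeasurable (hVm.const_mul _))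
      fun ω => hle1 _ (mul_nonneg (Nat.cast_nonneg _) (sampleVariance_nonneg _))
  have hw : ∑ _π : Equiv.Perm (Fin m), 1 / N = 1 := by
    rw [Finset.sum_const, Finset.card_univ, nsmul_eq_mul, ← hN]
    field_simp
  calc _ ≤ ∫ ω, ∑ π : Equiv.Perm (Fin m), 1 / N *
          Real.exp (-c * pairedSum (fun i => X i ω) π) ∂μ := by
        refine integral_mono hVi (integrable_finsetSum _ fun π _ => (hPi π).const_mul _)
          fun ω => ?_
        -- The paired sums of different permutations are dependent; Jensen's inequality needs only
        -- that the weights `1/N` sum to one.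
        have hJ := convexOn_exp.map_sum_le (t := Finset.univ)
          (w := fun _ : Equiv.Perm (Fin m) => 1 / N)
          (p := fun π => -c * pairedSum (fun i => X i ω) π)
          (fun _ _ => by positivity) hw (fun _ _ => Set.mem_univ _)
        simp only [smul_eq_mul] at hJ
        refine le_trans (le_of_eq ?_) hJ
        simp only [hVeq, Finset.mul_sum]
        congr 1
        refine Finset.sum_congr rfl fun π _ => ?_
        ring
    _ = ∑ π : Equiv.Perm (Fin m), 1 / N * mgf (fun ω => pairedSum (fun i => X i ω) π) μ (-c) := by
        rw [integral_finsetSum _ fun π _ => (hPi π).const_mul _]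
        simp_rw [integral_const_mul]
        rfl
    _ ≤ ∑ _π : Equiv.Perm (Fin m), 1 / N *
          Real.exp (-((m / 2 : ℕ) * ((c - c ^ 2 / 4) * v))) := by
        gcongr with π _
        exact mgf_pairedSum_le hX hb hindep he hv hc π
    _ = _ := by rw [← Finset.sum_mul, hw, one_mul]

/-- The standard deviation is rarely much larger than the sample standard deviation. -/
lemma measureReal_sqrt_sampleVariance_lt {m : ℕ} (hm : 1 < m) {X : Fin m → Ω → ℝ}
    (hX : ∀ i, AEMeasurable (X i) μ) (hb : ∀ i ω, X i ω ∈ Set.Icc (0 : ℝ) 1)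
    (hindep : iIndepFun X μ) {e v L : ℝ} (he : ∀ i, μ[X i] = e) (hv : ∀ i, Var[X i; μ] = v)
    (hL : 0 < L) :
    μ.real {ω | √(FirstStage.sampleVariance (fun i => X i ω)) + √(2 * L / (m - 1)) < √v} ≤
      Real.exp (-L) := by
  have hm1 : (0 : ℝ) < (m : ℝ) - 1 := by
    have : (1 : ℝ) < m := by exact_mod_cast hm
    linarith
  have hv0 : 0 ≤ v := by rw [← hv ⟨0, by omega⟩]; exact variance_nonneg _ _
  rcases hv0.eq_or_lt with rfl | hvpos
  · have hempty : {ω | √(FirstStage.sampleVariance (fun i => X i ω)) + √(2 * L / (m - 1)) < √0} =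
        ∅ := by
      ext ω
      simp only [Real.sqrt_zero, Set.mem_ofPred_eq, Set.mem_empty_iff_false, iff_false, not_lt]
      positivity
    rw [hempty]
    simpa using (Real.exp_pos _).le
  · set k : ℝ := ((m / 2 : ℕ) : ℝ) with hk
    -- For odd `m` one entry stays unpaired; this is why the bound has `m - 1` in place of `m`.
    have hk2 : (m : ℝ) - 1 ≤ 2 * k := by
      have : m ≤ 2 * (m / 2) + 1 := by omega
      have : (m : ℝ) ≤ 2 * k + 1 := by rw [hk]; exact_mod_cast this
      linarith
    have hk0 : 0 < k := by linarith
    set r : ℝ := √(2 * L / (m - 1)) with hr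
    have hr0 : 0 < r := by positivity
    have hr2 : r ^ 2 = 2 * L / (m - 1) := Real.sq_sqrt (by positivity)
    set w : ℝ := √v with hw
    have hw0 : 0 < w := Real.sqrt_pos.2 hvpos
    have hw2 : w ^ 2 = v := Real.sq_sqrt hv0
    -- The maximizer of `c w r - c² w²/4`; the exponent becomes `-k r² ≤ -L`.
    set c : ℝ := 2 * r / w with hc
    have hc0 : 0 ≤ c := by positivity
    have hcw : c * w = 2 * r := by rw [hc]; field_simp
    have hVm : AEMeasurable (fun ω => k * FirstStage.sampleVariance (fun i => X i ω)) μ := by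
      simp_rw [sampleVariance_eq_sum_sum]
      refine (AEMeasurable.const_mul ?_ _).const_mul _
      exact Finset.aemeasurable_fun_sum _ fun i _ => Finset.aemeasurable_fun_sum _ fun j _ => by
        fun_prop
    have hint : Integrable (fun ω => Real.exp
        (-c * (k * FirstStage.sampleVariance (fun i => X i ω)))) μ :=
      integrable_of_mem_Icc (a := 0) (b := 1)
        (Real.measurable_exp.comp_aemeasurable (hVm.const_mul _))
        fun ω => ⟨(Real.exp_pos _).le, Real.exp_le_one_iff.2 (by
          have := sampleVariance_nonneg (fun i => X i ω)
          have : 0 ≤ c * (k * FirstStage.sampleVariance (fun i => X i ω)) := by positivity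
          linarith)⟩
    have hch := measure_le_le_exp_mul_mgf (k * (v - w * r)) (neg_nonpos.2 hc0) hint
    -- The event forces `r < w`, hence the sample variance is below `(w - r)² ≤ w² - w r`.
    have hsub : {ω | √(FirstStage.sampleVariance (fun i => X i ω)) + r < w} ⊆
        {ω | k * FirstStage.sampleVariance (fun i => X i ω) ≤ k * (v - w * r)} := by
      intro ω hω
      simp only [Set.mem_ofPred_eq] at hω ⊢
      refine mul_le_mul_of_nonneg_left ?_ hk0.le
      have h1 := Real.sq_sqrt (sampleVariance_nonneg (fun i => X i ω))
      have h2 := Real.sqrt_nonneg (FirstStage.sampleVariance (fun i => X i ω))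
      rw [← h1, ← hw2]
      nlinarith
    refine (measureReal_mono hsub).trans (hch.trans ?_)
    refine (mul_le_mul_of_nonneg_left (mgf_sampleVariance_le hm hX hb hindep he hv hc0)
      (Real.exp_pos _).le).trans ?_
    rw [← Real.exp_add]
    refine Real.exp_le_exp.2 ?_
    have h1 : -(-c) * (k * (v - w * r)) + -(k * ((c - c ^ 2 / 4) * v)) = -(k * r ^ 2) := by
      rw [← hw2]
      linear_combination (-k * r + k * (c * w + 2 * r) / 4) * hcw
    rw [h1, hr2]
    have h2 : (m - 1) / 2 * (2 * L / (m - 1)) ≤ k * (2 * L / (m - 1)) := by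
      gcongr
      linarith
    have h3 : ((m : ℝ) - 1) / 2 * (2 * L / (m - 1)) = L := by field_simp
    linarith

/-- The empirical Bernstein inequality of Maurer and Pontil. -/
theorem measureReal_empirical_bernstein {m : ℕ} (hm : 1 < m) {X : Fin m → Ω → ℝ}
    (hX : ∀ i, AEMeasurable (X i) μ) (hb : ∀ i ω, X i ω ∈ Set.Icc (0 : ℝ) 1)
    (hindep : iIndepFun X μ) {e v L : ℝ} (he : ∀ i, μ[X i] = e) (hv : ∀ i, Var[X i; μ] = v)
    (hL : 0 < L) :
    μ.real {ω | e + √(2 * FirstStage.sampleVariance (fun i => X i ω) * L / m)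
      + 7 * L / (3 * (m - 1)) < (1 / m) * ∑ i, X i ω} ≤ 2 * Real.exp (-L) := by
  have hm1 : (1 : ℝ) < m := by exact_mod_cast hm
  have hm0 : (0 : ℝ) < (m : ℝ) - 1 := by linarith
  have hsub : {ω | e + √(2 * FirstStage.sampleVariance (fun i => X i ω) * L / m)
      + 7 * L / (3 * (m - 1)) < (1 / m) * ∑ i, X i ω} ⊆
      {ω | e + √(2 * v * L / m) + L / (3 * m) < (1 / m) * ∑ i, X i ω} ∪
      {ω | √(FirstStage.sampleVariance (fun i => X i ω)) + √(2 * L / (m - 1)) < √v} := by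
    intro ω hω
    by_contra hcon
    simp only [Set.mem_union, Set.mem_ofPred_eq, not_or, not_lt] at hω hcon
    obtain ⟨h1, h2⟩ := hcon
    set V := FirstStage.sampleVariance (fun i => X i ω)
    have hs : ∀ x : ℝ, √(2 * x * L / m) = √x * √(2 * L / m) := fun x => by
      rw [← Real.sqrt_mul' _ (by positivity)]
      congr 1
      ring
    have h3 : √(2 * v * L / m) ≤ √(2 * V * L / m) + √(2 * L / (m - 1)) * √(2 * L / m) := by
      rw [hs, hs, ← add_mul]
      exact mul_le_mul_of_nonneg_right h2 (Real.sqrt_nonneg _)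
    have h4 : √(2 * L / (m - 1)) * √(2 * L / m) ≤ 2 * L / (m - 1) := by
      calc _ ≤ √(2 * L / (m - 1)) * √(2 * L / (m - 1)) := by
            gcongr
            linarith
        _ = _ := Real.mul_self_sqrt (by positivity)
    have h5 : L / (3 * m) ≤ L / (3 * (m - 1)) := by
      gcongr
      linarith
    -- Origin of the constant: `2` from replacing `√v` by the sample deviation, `1/3` from
    -- Bernstein, together `7/3`.
    have h6 : 2 * L / ((m : ℝ) - 1) + L / (3 * (m - 1)) = 7 * L / (3 * (m - 1)) := by
      field_simp
      ring
    linarith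
  have := measureReal_bernstein (by omega) hX hb hindep he hv hL
  have := measureReal_sqrt_sampleVariance_lt hm hX hb hindep he hv hL
  linarith [measureReal_mono (μ := μ) hsub, measureReal_union_le (μ := μ)
    {ω | e + √(2 * v * L / m) + L / (3 * m) < (1 / m) * ∑ i, X i ω}
    {ω | √(FirstStage.sampleVariance (fun i => X i ω)) + √(2 * L / (m - 1)) < √v}]

end LowerTail

/-! ### Rescaling from `[0, 1]` to `[0, b]` -/

section Scaled

variable {Ω : Type*} [MeasurableSpace Ω] {μ : Measure Ω} [IsProbabilityMeasure μ]

/-- The empirical Bernstein inequality for variables with values in `[0, b]`. -/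
theorem measureReal_empirical_bernstein_of_mem_Icc {m : ℕ} (hm : 1 < m) {Z : Fin m → Ω → ℝ}
    {b : ℝ} (hbpos : 0 < b) (hZ : ∀ i, AEMeasurable (Z i) μ)
    (hb : ∀ i ω, Z i ω ∈ Set.Icc (0 : ℝ) b) (hindep : iIndepFun Z μ) {e v L : ℝ}
    (he : ∀ i, μ[Z i] = e) (hv : ∀ i, Var[Z i; μ] = v) (hL : 0 < L) :
    μ.real {ω | e + √(2 * FirstStage.sampleVariance (fun i => Z i ω) * L / m)
      + 7 * b * L / (3 * (m - 1)) < (1 / m) * ∑ i, Z i ω} ≤ 2 * Real.exp (-L) := by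
  have h := measureReal_empirical_bernstein hm (X := fun i ω => b⁻¹ * Z i ω) (μ := μ)
    (fun i => (hZ i).const_mul _)
    (fun i ω => ⟨mul_nonneg (by positivity) (hb i ω).1, by
      rw [inv_mul_le_iff₀ hbpos, mul_one]; exact (hb i ω).2⟩)
    (hindep.comp (fun _ x => b⁻¹ * x) fun _ => by fun_prop) (e := b⁻¹ * e) (v := b⁻¹ ^ 2 * v)
    (fun i => by rw [integral_const_mul, he]) (fun i => by rw [variance_const_mul, hv]) hL
  refine (measureReal_mono fun ω hω => ?_).trans h
  simp only [Set.mem_ofPred_eq, sampleVariance_const_mul, ← Finset.mul_sum] at hω ⊢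
  have hs : √(2 * (b⁻¹ ^ 2 * FirstStage.sampleVariance (fun i => Z i ω)) * L / m) =
      b⁻¹ * √(2 * FirstStage.sampleVariance (fun i => Z i ω) * L / m) := by
    rw [← Real.sqrt_sq (inv_nonneg.2 hbpos.le), ← Real.sqrt_mul (sq_nonneg _),
      Real.sqrt_sq (inv_nonneg.2 hbpos.le)]
    congr 1
    ring
  have h7 : 7 * L / (3 * ((m : ℝ) - 1)) = b⁻¹ * (7 * b * L / (3 * (m - 1))) := by
    field_simp
  rw [hs, h7, ← mul_add, ← mul_add, mul_left_comm]
  exact mul_lt_mul_of_pos_left hω (inv_pos.2 hbpos)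

end Scaled

/-! ### Measurability, range and bias of the clipped estimate -/

section CIPW

variable {𝒬 : Type*} [MeasurableSpace 𝒬] {n : ℕ}
  {κ : Kernel (𝒬 × (Fin n → Bool)) (Fin n → Bool)}

/-- Needed because the item at a given rank depends on the query, so coordinates are evaluated at a
random index. -/
lemma measurable_apply_of_countable {α ι β : Type*} [MeasurableSpace α] [MeasurableSpace ι]
    [MeasurableSpace β] [Countable ι] [MeasurableSingletonClass ι] {F : ι → α → β}
    (hF : ∀ i, Measurable (F i)) {s : α → ι} (hs : Measurable s) :
    Measurable fun x => F (s x) x :=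
  (measurable_from_prod_countable_left (f := fun p : α × ι => F p.2 p.1) hF).comp
    (measurable_id.prodMk hs)

lemma measurable_propensity (j : Fin n) :
    Measurable fun x : 𝒬 × (Fin n → Bool) => FirstStage.propensity κ x.1 x.2 j := by
  have hs : MeasurableSet {o : Fin n → Bool | o j = true} := by measurability
  exact (Kernel.measurable_coe κ hs).ennreal_toReal

variable (κ) in
/-- The clipped inverse propensity weighted estimate as a function of a request and the
observations of the user. -/
noncomputable def cipwOfObservation (rank : 𝒬 → ℕ → Fin n) (lam : ℝ) (t : ℕ)
    (p : (𝒬 × (Fin n → Bool)) × (Fin n → Bool)) : ℝ :=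
  FirstStage.cipwScore rank lam t ⟨p.1.1, FirstStage.clicks p.2 p.1.2,
    FirstStage.propensity κ p.1.1 p.1.2⟩

variable {rank : 𝒬 → ℕ → Fin n} {t : ℕ} {lam : ℝ}

lemma cipwOfObservation_eq_sum (p : (𝒬 × (Fin n → Bool)) × (Fin n → Bool)) :
    cipwOfObservation κ rank lam t p = ∑ j ∈ Finset.Icc 1 t,
      min lam (1 / FirstStage.propensity κ p.1.1 p.1.2 (rank p.1.1 j)) *
        ((FirstStage.clicks p.2 p.1.2 (rank p.1.1 j)).toNat : ℝ) := rfl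

lemma measurable_cipwOfObservation_term {j : ℕ} (hr : Measurable fun q => rank q j) :
    Measurable fun p : (𝒬 × (Fin n → Bool)) × (Fin n → Bool) =>
      min lam (1 / FirstStage.propensity κ p.1.1 p.1.2 (rank p.1.1 j)) *
        ((FirstStage.clicks p.2 p.1.2 (rank p.1.1 j)).toNat : ℝ) := by
  have hF : ∀ i : Fin n, Measurable fun p : (𝒬 × (Fin n → Bool)) × (Fin n → Bool) =>
      min lam (1 / FirstStage.propensity κ p.1.1 p.1.2 i) *
        ((FirstStage.clicks p.2 p.1.2 i).toNat : ℝ) := by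
    intro i
    have h0 : Measurable fun p : (𝒬 × (Fin n → Bool)) × (Fin n → Bool) =>
        FirstStage.propensity κ p.1.1 p.1.2 i := (measurable_propensity i).comp measurable_fst
    have h1 : Measurable fun p : (𝒬 × (Fin n → Bool)) × (Fin n → Bool) => (p.2 i, p.1.2 i) := by
      fun_prop
    have h2 : Measurable fun p : (𝒬 × (Fin n → Bool)) × (Fin n → Bool) =>
        ((FirstStage.clicks p.2 p.1.2 i).toNat : ℝ) :=
      (Measurable.of_discrete (f := fun b : Bool × Bool => (((b.1 && b.2).toNat : ℕ) : ℝ))).comp h1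
    exact (measurable_const.min (h0.const_div 1)).mul h2
  have hs : Measurable fun p : (𝒬 × (Fin n → Bool)) × (Fin n → Bool) => rank p.1.1 j :=
    hr.comp (measurable_fst.comp measurable_fst)
  exact measurable_apply_of_countable hF hs

lemma measurable_cipwOfObservation (hr : ∀ j ∈ Finset.Icc 1 t, Measurable fun q => rank q j) :
    Measurable (cipwOfObservation κ rank lam t) :=
  Finset.measurable_fun_sum _ fun j hj => measurable_cipwOfObservation_term (hr j hj)

lemma propensity_nonneg (q : 𝒬) (r : Fin n → Bool) (j : Fin n) :
    0 ≤ FirstStage.propensity κ q r j := measureReal_nonneg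

lemma cipwOfObservation_mem_Icc (hlam : 0 < lam) (p : (𝒬 × (Fin n → Bool)) × (Fin n → Bool)) :
    cipwOfObservation κ rank lam t p ∈ Set.Icc 0 (t * lam) := by
  have hmin : ∀ j, 0 ≤ min lam (1 / FirstStage.propensity κ p.1.1 p.1.2 j) := fun j =>
    le_min hlam.le (one_div_nonneg.2 (propensity_nonneg _ _ _))
  rw [cipwOfObservation_eq_sum]
  refine ⟨Finset.sum_nonneg fun j _ => mul_nonneg (hmin _) (Nat.cast_nonneg _), ?_⟩
  calc _ ≤ ∑ _j ∈ Finset.Icc 1 t, lam := by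
        refine Finset.sum_le_sum fun j _ => ?_
        refine (mul_le_mul (min_le_left _ _) ?_ (Nat.cast_nonneg _) hlam.le).trans_eq (mul_one _)
        exact_mod_cast Bool.toNat_le _
    _ = t * lam := by simp

/-- The conditional expectation of a click, weighted by the clipped inverse propensity, is at most
the relevance. -/
lemma integral_min_mul_clicks_le [IsMarkovKernel κ] (x : 𝒬 × (Fin n → Bool)) (j : Fin n) :
    ∫ o, min lam (1 / FirstStage.propensity κ x.1 x.2 j) *
      ((FirstStage.clicks o x.2 j).toNat : ℝ) ∂(κ x) ≤ ((x.2 j).toNat : ℝ) := by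
  have hs : MeasurableSet {o : Fin n → Bool | o j = true} := by measurability
  have hind : ∀ o : Fin n → Bool, ((FirstStage.clicks o x.2 j).toNat : ℝ) =
      {o : Fin n → Bool | o j = true}.indicator (fun _ => (1 : ℝ)) o * ((x.2 j).toNat : ℝ) := by
    intro o
    cases h : o j <;> cases h' : x.2 j <;> simp [FirstStage.clicks, h, h']
  simp_rw [hind]
  rw [integral_const_mul, integral_mul_const, integral_indicator_const _ hs, smul_eq_mul, mul_one,
    ← mul_assoc]
  refine mul_le_of_le_one_left (Nat.cast_nonneg _) ?_
  -- At propensity `0` the convention `1 / 0 = 0` makes the last product `0`, so the bound by `1`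
  -- still holds.
  calc min lam (1 / FirstStage.propensity κ x.1 x.2 j) * FirstStage.propensity κ x.1 x.2 j
      ≤ 1 / FirstStage.propensity κ x.1 x.2 j * FirstStage.propensity κ x.1 x.2 j :=
        mul_le_mul_of_nonneg_right (min_le_right _ _) (propensity_nonneg _ _ _)
    _ ≤ 1 := by rw [one_div]; exact inv_mul_le_one

/-- The clipped inverse propensity weighted estimate underestimates the number of relevant items
in expectation. -/
lemma integral_cipwOfObservation_le [IsMarkovKernel κ] (P : Measure (𝒬 × (Fin n → Bool)))
    [IsProbabilityMeasure P] (hlam : 0 < lam)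
    (hr : ∀ j ∈ Finset.Icc 1 t, Measurable fun q => rank q j) :
    ∫ p, cipwOfObservation κ rank lam t p ∂(P ⊗ₘ κ) ≤ FirstStage.expectedRelevant P rank t := by
  have hint : Integrable (cipwOfObservation κ rank lam t) (P ⊗ₘ κ) :=
    integrable_of_mem_Icc (measurable_cipwOfObservation hr).aemeasurable
      (cipwOfObservation_mem_Icc hlam)
  rw [Measure.integral_compProd hint]
  refine integral_mono hint.integral_compProd ?_ fun x => ?_
  · refine integrable_finsetSum _ fun j hj => ?_
    refine integrable_of_mem_Icc (a := 0) (b := 1) (Measurable.aemeasurable ?_) fun x =>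
      ⟨Nat.cast_nonneg _, by exact_mod_cast Bool.toNat_le _⟩
    have hrj := hr j hj
    refine measurable_apply_of_countable (s := fun x : 𝒬 × (Fin n → Bool) => rank x.1 j)
      (F := fun i x => ((x.2 i).toNat : ℝ)) (fun i => ?_) (by fun_prop)
    exact (measurable_from_top (f := fun b : Bool => ((b.toNat : ℕ) : ℝ))).comp
      ((measurable_pi_apply i).comp measurable_snd)
  · have hsum : ∫ o, cipwOfObservation κ rank lam t (x, o) ∂(κ x) = ∑ j ∈ Finset.Icc 1 t,
        ∫ o, min lam (1 / FirstStage.propensity κ x.1 x.2 (rank x.1 j)) *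
          ((FirstStage.clicks o x.2 (rank x.1 j)).toNat : ℝ) ∂(κ x) := by
      simp_rw [cipwOfObservation_eq_sum]
      refine integral_finsetSum _ fun j _ => ?_
      exact Integrable.of_finite
    simp only [hsum]
    exact Finset.sum_le_sum fun j _ => integral_min_mul_clicks_le x _

end CIPW

/-! ### The lower confidence bound -/

theorem proposition3
    -- items, groups, relevance model
    {𝒬 𝒟 𝒢 : Type*} [MeasurableSpace 𝒬] {n : ℕ} (d : Fin n → 𝒟)
    (group : 𝒢 → Finset (Fin n)) (tmax : 𝒢 → ℕ) (htmax : ∀ g, tmax g ≤ (group g).card)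
    (f : 𝒬 → 𝒟 → unitInterval)
    -- the rankings of the groups by the relevance model
    (σ : 𝒬 → 𝒢 → ℕ → Fin n)
    (hσ : ∀ q g, FirstStage.IsRanking (fun j => (f q (d j) : ℝ)) (group g) (σ q g))
    (hσ_meas : ∀ g, ∀ j ∈ Finset.Icc 1 (group g).card, Measurable (fun q => σ q g j))
    -- law of a request, and conditional law of the observations under the logging policy
    (P : Measure (𝒬 × (Fin n → Bool))) [IsProbabilityMeasure P]
    (κ : Kernel (𝒬 × (Fin n → Bool)) (Fin n → Bool)) [IsMarkovKernel κ]
    (hpos : ∃ γ : ℝ, 0 < γ ∧ ∀ g q r, ∀ j ∈ Finset.Icc 1 (tmax g),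
      γ < FirstStage.propensity κ q r (σ q g j))
    -- the i.i.d. requests
    {Ω : Type*} [MeasurableSpace Ω] (μ : Measure Ω) [IsProbabilityMeasure μ]
    (m : ℕ) (hm : 1 < m)
    (Q : Fin m → Ω → 𝒬) (R O : Fin m → Ω → Fin n → Bool)
    (hlaw : ∀ i, HasLaw (fun ω => ((Q i ω, R i ω), O i ω)) (P ⊗ₘ κ) μ)
    (hindep : iIndepFun (fun i ω => ((Q i ω, R i ω), O i ω)) μ)
    (lam : ℝ) (hlam : 0 < lam) (g : 𝒢) (t : ℕ) (ht : t ∈ Finset.Icc 1 (tmax g - 1))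
    (α : ℝ) (hα : α ∈ Set.Ioo (0 : ℝ) 1) :
    1 - α ≤ μ.real {ω | FirstStage.expectedRelevant P (fun q => σ q g) t ≥
      FirstStage.lowerBound (fun q => σ q g) lam t α
        (fun i => ⟨Q i ω, FirstStage.clicks (O i ω) (R i ω),
          FirstStage.propensity κ (Q i ω) (R i ω)⟩)} := by
  obtain ⟨hα0, hα1⟩ := hα
  have htm : 1 ≤ t ∧ t ≤ (group g).card := by
    have := htmax g
    have := Finset.mem_Icc.1 ht
    omega
  have hr : ∀ j ∈ Finset.Icc 1 t, Measurable fun q => σ q g j := fun j hj => by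
    refine hσ_meas g j (Finset.mem_Icc.2 ?_)
    have := Finset.mem_Icc.1 hj
    omega
  set φ := cipwOfObservation κ (fun q => σ q g) lam t with hφ
  have hφm : Measurable φ := measurable_cipwOfObservation hr
  set T : Fin m → Ω → (𝒬 × (Fin n → Bool)) × (Fin n → Bool) :=
    fun i ω => ((Q i ω, R i ω), O i ω) with hT
  have hTm : ∀ i, AEMeasurable (T i) μ := fun i => (hlaw i).aemeasurable
  have hZlaw : ∀ i, HasLaw (fun ω => φ (T i ω)) ((P ⊗ₘ κ).map φ) μ := fun i =>
    ⟨hφm.comp_aemeasurable (hTm i), by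
      rw [← (hlaw i).map_eq, AEMeasurable.map_map_of_aemeasurable hφm.aemeasurable (hTm i)]
      rfl⟩
  -- With `L = ln(2/α)` the failure probability `2 e^{-L}` is exactly `α`.
  have hL : 0 < Real.log (2 / α) := Real.log_pos (by rw [lt_div_iff₀ hα0]; linarith)
  have hexp : 2 * Real.exp (-Real.log (2 / α)) = α := by
    rw [Real.exp_neg, Real.exp_log (by positivity)]
    field_simp
  have ht0 : (0 : ℝ) < t := by exact_mod_cast htm.1
  have hmain := measureReal_empirical_bernstein_of_mem_Icc hm (Z := fun i ω => φ (T i ω))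
    (mul_pos ht0 hlam) (fun i => (hZlaw i).aemeasurable)
    (fun i ω => cipwOfObservation_mem_Icc hlam (T i ω)) (hindep.comp (fun _ => φ) fun _ => hφm)
    (e := ∫ p, φ p ∂(P ⊗ₘ κ)) (v := Var[id; (P ⊗ₘ κ).map φ])
    (fun i => (hlaw i).integral_comp hφm.aestronglyMeasurable) (fun i => (hZlaw i).variance_eq) hL
  rw [hexp] at hmain
  have hU : ∫ p, φ p ∂(P ⊗ₘ κ) ≤ FirstStage.expectedRelevant P (fun q => σ q g) t :=
    integral_cipwOfObservation_le P hlam hr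
  set B := {ω | ∫ p, φ p ∂(P ⊗ₘ κ)
    + √(2 * FirstStage.sampleVariance (fun i => φ (T i ω)) * Real.log (2 / α) / m)
      + 7 * (t * lam) * Real.log (2 / α) / (3 * (m - 1)) < (1 / m) * ∑ i, φ (T i ω)} with hB
  -- Covering the space by the good event and `B` and using subadditivity of `μ` avoids complements,
  -- so neither event has to be shown measurable.
  have hcover : Set.univ ⊆ {ω | FirstStage.expectedRelevant P (fun q => σ q g) t ≥
      FirstStage.lowerBound (fun q => σ q g) lam t α
        (fun i => ⟨Q i ω, FirstStage.clicks (O i ω) (R i ω),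
          FirstStage.propensity κ (Q i ω) (R i ω)⟩)} ∪ B := by
    intro ω _
    by_cases hω : ω ∈ B
    · exact Or.inr hω
    · refine Or.inl ?_
      simp only [hB, Set.mem_ofPred_eq, not_lt] at hω
      change (1 / (m : ℝ)) * ∑ i, φ (T i ω)
        - √(2 * FirstStage.sampleVariance (fun i => φ (T i ω)) * Real.log (2 / α) / m)
        - 7 * t * lam * Real.log (2 / α) / (3 * ((m : ℝ) - 1)) ≤ _
      rw [← mul_assoc] at hω
      linarith
  have h1 := (measureReal_mono (μ := μ) hcover).trans (measureReal_union_le _ _)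
  rw [probReal_univ] at h1
  linarith
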